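/- Let $n$ be a positive integer, let $\Sigma_n$ be the symmetric group of degree $n$, and let $F$ be a field with $\operatorname{char} F\neq 2$. For a partition $\mu$ of $n$ let $M^{\mu}$ be the $F\Sigma_n$-module of all formal $F$-linear combinations of $\mu$-tabloids, and let the Specht module $S^{\mu}$ be the submodule of $M^{\mu}$ spanned by the polytabloids $e_t=\sum_{\pi\in C_t}\operatorname{sgn}(\pi)\,\{t\pi\}$, where $t$ runs over the $\mu$-tableaux and $C_t$ is the column stabilizer of $t$. Let $M$ be an $F\Sigma_n$-module such that: 1. $M$ has a Specht series $0=M_0\subset M_1\subset\cdots\subset M_m=M$, i.e. a chain of $F\Sigma_n$-submodules with $M_u/M_{u-1}\cong S^{\lambda_u}$ for a partition $\lambda_u$ of $n$, for each $u=1,\dots,m$; 2. $\lambda_1\triangleleft\lambda_2\triangleleft\cdots\triangleleft\lambda_m$, where $\triangleleft$ is the strict dominance order on partitions of $n$; 3. there is an element $z$ of the center $Z(F\Sigma_n)$ such that the minimal polynomial over $F$ of the action of $z$ on $M$ has degree $m$. Let $B$ be a block idempotent of $F\Sigma_n$, that is, a primitive idempotent of $Z(F\Sigma_n)$. Then the $F\Sigma_n$-module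 $MB$ is $0$ or indecomposable. -/

import Mathlib

open Equiv

noncomputable section

namespace SpechtBranching

/-! ### Partitions, tableaux, tabloids -/

/-- A partition of `n`, presented by its Young diagram: a Young diagram with `n` nodes.
The parts of the partition are the row lengths `μ.rowLen 0 ≥ μ.rowLen 1 ≥ ...`. -/
def PartitionOf (n : ℕ) : Type := {μ : YoungDiagram // μ.card = n}

/-- The `i`-th part (counting from `0`, and `0` beyond the last nonzero part). -/
def PartitionOf.part {n : ℕ} (μ : PartitionOf n) (i : ℕ) : ℕ := μ.1.rowLen i

/-- The dominance order: every partial sum of parts of `μ` is at most that of `ν`. -/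
def Dominates {n : ℕ} (ν μ : PartitionOf n) : Prop :=
  ∀ k : ℕ, ∑ i ∈ Finset.range k, μ.part i ≤ ∑ i ∈ Finset.range k, ν.part i

/-- Strict dominance: `ν` dominates `μ` and `ν ≠ μ`. -/
def StrictlyDominates {n : ℕ} (ν μ : PartitionOf n) : Prop :=
  Dominates ν μ ∧ ν ≠ μ

/-- A `μ`-tableau: a bijection from the nodes `(row, column)` of the diagram of `μ` to the
`n` letters. -/
abbrev Tableau {n : ℕ} (μ : PartitionOf n) : Type := {c : ℕ × ℕ // c ∈ μ.1.cells} ≃ Fin n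

/-- The row of the tableau `t` that contains the letter `x`. -/
def Tableau.row {n : ℕ} {μ : PartitionOf n} (t : Tableau μ) (x : Fin n) : ℕ :=
  (Equiv.symm t x).1.1

/-- The column of the tableau `t` that contains the letter `x`. -/
def Tableau.col {n : ℕ} {μ : PartitionOf n} (t : Tableau μ) (x : Fin n) : ℕ :=
  (Equiv.symm t x).1.2

/-- A `μ`-tabloid: an ordered set partition `(P₀, P₁, ...)` of the letters in which `Pᵢ` has as
many elements as the `i`-th part of `μ`. It is recorded by the map sending a letter to the index
of the set containing it. -/
def Tabloid {n : ℕ} (μ : PartitionOf n) : Type :=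
  {f : Fin n → ℕ // ∀ i : ℕ, (Finset.univ.filter fun x => f x = i).card = μ.part i}

/-- The tabloid `{t}` of a tableau `t`: its `i`-th set is the set of entries in row `i`. -/
def Tableau.tabloid {n : ℕ} {μ : PartitionOf n} (t : Tableau μ) : Tabloid μ :=
  ⟨t.row, fun i => by
    rw [PartitionOf.part, YoungDiagram.rowLen_eq_card]
    refine Finset.card_bij (fun x _ => (Equiv.symm t x).1) ?_ ?_ ?_
    · intro x hx
      exact Finset.mem_filter.2 ⟨(Equiv.symm t x).2, (Finset.mem_filter.1 hx).2⟩
    · intro x _ y _ h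
      exact (Equiv.symm t).injective (Subtype.ext h)
    · intro c hc
      have hc' := Finset.mem_filter.1 hc
      refine ⟨t ⟨c, hc'.1⟩, ?_, ?_⟩
      · refine Finset.mem_filter.2 ⟨Finset.mem_univ _, ?_⟩
        simpa [Tableau.row] using hc'.2
      · simp⟩

/-- Permutations of the letters act on tabloids by moving the letters. -/
instance {n : ℕ} (μ : PartitionOf n) : MulAction (Perm (Fin n)) (Tabloid μ) where
  smul g T := ⟨fun x => T.1 (g⁻¹ x), fun i => by
    rw [← T.2 i]
    refine Finset.card_bij (fun x _ => g⁻¹ x) ?_ ?_ ?_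
    · intro x hx
      simpa using hx
    · intro x _ y _ h
      exact g⁻¹.injective h
    · intro y hy
      exact ⟨g y, by simpa using hy, by simp⟩⟩
  one_smul T := Subtype.ext (funext fun _ => rfl)
  mul_smul g h T := Subtype.ext (funext fun x => by
    change T.1 ((g * h)⁻¹ x) = T.1 (h⁻¹ (g⁻¹ x))
    rw [mul_inv_rev, Perm.mul_apply])

/-! ### Specht modules

Modules are left modules over the group algebra; a right module is turned into a left one by
letting `g` act as `g⁻¹` did. -/

/-- The permutation representation on formal linear combinations of `μ`-tabloids. -/
def tabloidRep (F : Type*) [Field F] {n : ℕ} (μ : PartitionOf n) :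
    Representation F (Perm (Fin n)) (Tabloid μ →₀ F) where
  toFun g := Finsupp.lmapDomain F F (g • ·)
  map_one' := by ext; simp
  map_mul' g h := by ext; simp [mul_smul]

/-- The permutation module `M^μ`: all formal linear combinations of `μ`-tabloids. -/
def TabloidModule (F : Type*) [Field F] {n : ℕ} (μ : PartitionOf n) : Type _ :=
  Tabloid μ →₀ F

instance (F : Type*) [Field F] {n : ℕ} (μ : PartitionOf n) : AddCommGroup (TabloidModule F μ) :=
  inferInstanceAs (AddCommGroup (Tabloid μ →₀ F))

instance (F : Type*) [Field F] {n : ℕ} (μ : PartitionOf n) : Module F (TabloidModule F μ) :=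
  inferInstanceAs (Module F (Tabloid μ →₀ F))

/-- The permutation module as a module over the group algebra of the symmetric group. -/
instance (F : Type*) [Field F] {n : ℕ} (μ : PartitionOf n) :
    Module (MonoidAlgebra F (Perm (Fin n))) (TabloidModule F μ) :=
  inferInstanceAs (Module (MonoidAlgebra F (Perm (Fin n))) (tabloidRep F μ).asModule)

instance (F : Type*) [Field F] {n : ℕ} (μ : PartitionOf n) :
    IsScalarTower F (MonoidAlgebra F (Perm (Fin n))) (TabloidModule F μ) :=
  inferInstanceAs (IsScalarTower F (MonoidAlgebra F (Perm (Fin n))) (tabloidRep F μ).asModule)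

/-- The column stabilizer of `t`: the permutations fixing every column of `t` as a set. -/
def colStabilizer {n : ℕ} {μ : PartitionOf n} (t : Tableau μ) : Finset (Perm (Fin n)) :=
  Finset.univ.filter fun g => ∀ x, t.col (g x) = t.col x

/-- The polytabloid `e_t`, the signed sum of the images of `{t}` under the column stabilizer. -/
def polytabloid (F : Type*) [Field F] {n : ℕ} {μ : PartitionOf n} (t : Tableau μ) :
    TabloidModule F μ :=
  (∑ g ∈ colStabilizer t,
    Finsupp.single (g • t.tabloid) (((Perm.sign g : ℤˣ) : ℤ) : F) : Tabloid μ →₀ F)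

/-- The Specht module `S^μ`: the submodule of `M^μ` spanned by the polytabloids. -/
def spechtModule (F : Type*) [Field F] {n : ℕ} (μ : PartitionOf n) :
    Submodule (MonoidAlgebra F (Perm (Fin n))) (TabloidModule F μ) :=
  Submodule.span _ (Set.range (polytabloid F (μ := μ)))

/-- `0 = N 0 ⊆ N 1 ⊆ ... ⊆ N m = M` is a Specht series: the factor `N (u + 1) / N u` is
isomorphic to the Specht module of `lam u`. (The inclusions are strict, since Specht modules are
nonzero.) -/
structure IsSpechtSeries {F : Type*} [Field F] {n : ℕ} {M : Type*} [AddCommGroup M]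
    [Module (MonoidAlgebra F (Perm (Fin n))) M] {m : ℕ}
    (N : Fin (m + 1) → Submodule (MonoidAlgebra F (Perm (Fin n))) M)
    (lam : Fin m → PartitionOf n) : Prop where
  bot : N 0 = ⊥
  top : N (Fin.last m) = ⊤
  le : ∀ u : Fin m, N u.castSucc ≤ N u.succ
  factor : ∀ u : Fin m, Nonempty
    ((N u.succ ⧸ (N u.castSucc).submoduleOf (N u.succ))
      ≃ₗ[MonoidAlgebra F (Perm (Fin n))] spechtModule F (lam u))

/-! ### Blocks and indecomposability -/

/-- A block idempotent of a ring `A`: a primitive idempotent of the center of `A`, that is, a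
nonzero central idempotent `e` for which `0` and `e` are the only central idempotents `f` with
`f * e = f`. -/
structure IsBlockIdempotent {A : Type*} [Ring A] (e : A) : Prop where
  central : e ∈ Set.center A
  idem : IsIdempotentElem e
  ne_zero : e ≠ 0
  primitive : ∀ f ∈ Set.center A, IsIdempotentElem f → f * e = f → f = 0 ∨ f = e

/-- The submodule `e M = {e • x | x ∈ M}` of `M`, for a central element `e`. -/
def centralImage {A : Type*} [Ring A] (M : Type*) [AddCommGroup M] [Module A M]
    (e : A) (he : e ∈ Set.center A) : Submodule A M where
  carrier := Set.range fun x : M => e • x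
  add_mem' := by
    rintro _ _ ⟨x, rfl⟩ ⟨y, rfl⟩
    exact ⟨x + y, smul_add e x y⟩
  zero_mem' := ⟨0, smul_zero e⟩
  smul_mem' := by
    rintro a _ ⟨x, rfl⟩
    refine ⟨a • x, ?_⟩
    change e • a • x = a • e • x
    rw [smul_smul, smul_smul, (Set.mem_center_iff.1 he).comm a]

/-- A module is indecomposable if it is nonzero and is not the internal direct sum of two nonzero
submodules. -/
def IsIndecomposable (A : Type*) [Ring A] (M : Type*) [AddCommGroup M] [Module A M] : Prop :=
  Nontrivial M ∧ ∀ P Q : Submodule A M, IsCompl P Q → P = ⊥ ∨ Q = ⊥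

end SpechtBranching

end

namespace SpechtBranching

variable {F : Type*} [Field F] {n : ℕ} {lam mu : PartitionOf n}

/-! ### Tabloids that are injective on the columns of a tableau -/

/-! Outside characteristic 2, a nonzero homomorphism `S^λ → S^μ` forces `λ` to dominate `μ`, and
`End(S^λ) = F` (`specht_hom_specht_eq_zero`, `specht_end_scalar`). Both come from looking at which
tabloids can occur in the image of a polytabloid. Since the series climbs in dominance order, no
factor maps nontrivially to a higher one. Hence every endomorphism of `M` preserves the series and
acts on each factor by a scalar, which gives `m` ring homomorphisms `χ_u : End(M) → F`
(`factorHom`).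

If `e` is an idempotent endomorphism and `J(e)` is the set of `u` with `χ_u(e) ≠ 0`, then `z` on
`eM` is annihilated by the product of `X - χ_u(z)` over `J(e)` (`aeval_smul_idempotent`). In
particular `J(e)` is nonempty when `e ≠ 0`. On the factors where `B` acts nontrivially, `z` has one
and the same scalar `c` (`factorHom_eq_of_block`).

Suppose `BM` is a direct sum of two nonzero pieces with projections `e₁` and `e₂`, and put `e₃ = 1 -
B`. The three sets `J` are disjoint, and `z` satisfies a polynomial of degree `max(|J(e₁)|, |J(e₂)|)
+ |J(e₃)|`, because both pieces need only a power of `X - c`. This degree is less than `m`,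
contradicting the degree of the minimal polynomial (`natDegree_minpoly_lt`). -/

theorem Tableau.cell_mem (t : Tableau lam) (x : Fin n) : (t.row x, t.col x) ∈ lam.1 :=
  (YoungDiagram.mem_cells (c := (Equiv.symm t x).1)).1 (Equiv.symm t x).2

theorem Tableau.row_lt_colLen (t : Tableau lam) (x : Fin n) :
    t.row x < lam.1.colLen (t.col x) :=
  YoungDiagram.mem_iff_lt_colLen.1 (t.cell_mem x)

theorem Tableau.exists_letter (t : Tableau lam) {i j : ℕ} (h : (i, j) ∈ lam.1) :
    ∃ x, t.row x = i ∧ t.col x = j := by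
  refine ⟨t ⟨(i, j), (YoungDiagram.mem_cells _).2 h⟩, ?_, ?_⟩ <;> simp [Tableau.row, Tableau.col]

theorem Tableau.ext_row_col (t : Tableau lam) {x y : Fin n} (hr : t.row x = t.row y)
    (hc : t.col x = t.col y) : x = y :=
  (Equiv.symm t).injective (Subtype.ext (Prod.ext hr hc))

theorem Tabloid.sum_part (T : Tabloid mu) (k : ℕ) :
    ∑ i ∈ Finset.range k, mu.part i = (Finset.univ.filter fun x => T.1 x < k).card := by
  rw [Finset.card_eq_sum_card_fiberwise (f := T.1) (t := Finset.range k)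
    (fun x hx => by simpa using hx)]
  refine Finset.sum_congr rfl fun i hi => ?_
  rw [← T.2 i, Finset.filter_filter]
  congr 1
  ext x
  have := Finset.mem_range.1 hi
  simp only [Finset.mem_filter, Finset.mem_univ, true_and]
  omega

/-- No two letters of the same column of `t` lie in the same row of `T`. -/
def ColInjective (t : Tableau lam) (T : Tabloid mu) : Prop :=
  ∀ x y, t.col x = t.col y → T.1 x = T.1 y → x = y

/-- In a column of length `l`, the first `k` rows of `t` hold `min(k, l)` letters. On the left, the
letters have distinct `T`-rows below `k`, and there are at most `l` of them. -/
theorem card_column_le {t : Tableau lam} {T : Tabloid mu} (h : ColInjective t T) (k j : ℕ) :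
    (Finset.univ.filter fun x => T.1 x < k ∧ t.col x = j).card ≤
      (Finset.univ.filter fun x => t.row x < k ∧ t.col x = j).card := by
  rcases le_or_gt k (lam.1.colLen j) with hk | hk
  · calc _ ≤ (Finset.range k).card := by
          refine Finset.card_le_card_of_injOn T.1 (fun x hx => ?_) (fun x hx y hy hxy => ?_)
          · simp only [Finset.coe_filter, Set.mem_ofPred_eq] at hx
            simpa using hx.2.1
          · simp only [Finset.coe_filter, Set.mem_ofPred_eq] at hx hy
            exact h x y (hx.2.2.trans hy.2.2.symm) hxy
      _ ≤ _ := by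
          refine Finset.card_le_card_of_surjOn t.row fun i hi => ?_
          have hi' : i < k := by simpa using hi
          obtain ⟨x, hx, hx'⟩ := t.exists_letter
            (YoungDiagram.mem_iff_lt_colLen.2 (hi'.trans_le hk))
          exact ⟨x, by simp [hx, hx', hi'], hx⟩
  · refine Finset.card_le_card fun x hx => ?_
    simp only [Finset.mem_filter, Finset.mem_univ, true_and] at hx ⊢
    exact ⟨((hx.2 ▸ t.row_lt_colLen x).trans hk), hx.2⟩

theorem card_eq_sum_columns (t : Tableau lam) (p : Fin n → Prop) [DecidablePred p] :
    (Finset.univ.filter p).card = ∑ j ∈ Finset.univ.image t.col,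
      (Finset.univ.filter fun x => p x ∧ t.col x = j).card := by
  rw [Finset.card_eq_sum_card_fiberwise (f := t.col) (t := Finset.univ.image t.col)
    (fun x _ => by simp)]
  simp only [Finset.filter_filter]

theorem ColInjective.dominates {t : Tableau lam} {T : Tabloid mu} (h : ColInjective t T) :
    Dominates lam mu := by
  intro k
  rw [T.sum_part, t.tabloid.sum_part, card_eq_sum_columns t, card_eq_sum_columns t]
  exact Finset.sum_le_sum fun j _ => card_column_le h k j

/-- For equal shapes the columnwise inequalities of `card_column_le` add up to an equality, so each
is an equality. Taking `k` to be the length of the column of `y` makes the right-hand count the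
whole column. -/
theorem ColInjective.lt_colLen {t : Tableau lam} {T : Tabloid lam} (h : ColInjective t T)
    (y : Fin n) : T.1 y < lam.1.colLen (t.col y) := by
  set k := lam.1.colLen (t.col y) with hk
  have hsum := (T.sum_part k).symm.trans (t.tabloid.sum_part k)
  rw [card_eq_sum_columns t, card_eq_sum_columns t] at hsum
  have hcol := (Finset.sum_eq_sum_iff_of_le fun j _ => card_column_le h k j).1 hsum (t.col y)
    (by simp)
  have hsub : (Finset.univ.filter fun x => T.1 x < k ∧ t.col x = t.col y) ⊆
      Finset.univ.filter fun x => t.row x < k ∧ t.col x = t.col y := by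
    intro x hx
    simp only [Finset.mem_filter, Finset.mem_univ, true_and] at hx ⊢
    exact ⟨by rw [hk, ← hx.2]; exact t.row_lt_colLen x, hx.2⟩
  have hy : y ∈ Finset.univ.filter fun x => T.1 x < k ∧ t.col x = t.col y := by
    rw [Finset.eq_of_subset_of_card_le hsub hcol.ge]
    simpa using t.row_lt_colLen y
  exact (Finset.mem_filter.1 hy).2.1

theorem smul_tabloid_apply (g : Perm (Fin n)) (T : Tabloid mu) (x : Fin n) :
    (g • T).1 x = T.1 (g⁻¹ x) := rfl

/-- The permutation sends `y` to the letter of its own column in `t` whose row is `T.1 y`;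
injectivity on columns makes this map injective. -/
theorem ColInjective.exists_smul_eq {t : Tableau lam} {T : Tabloid lam} (h : ColInjective t T) :
    ∃ g ∈ colStabilizer t, T = g⁻¹ • t.tabloid := by
  choose s hrow hcol using fun y =>
    t.exists_letter (YoungDiagram.mem_iff_lt_colLen.2 (h.lt_colLen y))
  have hinj : Function.Injective s := fun x y hxy =>
    h x y (by rw [← hcol x, ← hcol y, hxy]) (by rw [← hrow x, ← hrow y, hxy])
  refine ⟨Equiv.ofBijective s (Finite.injective_iff_bijective.1 hinj), ?_, ?_⟩
  · simp [colStabilizer, hcol]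
  · refine Subtype.ext (funext fun x => ?_)
    rw [smul_tabloid_apply, inv_inv]
    exact (hrow x).symm

theorem dominates_antisymm (h : Dominates lam mu) (h' : Dominates mu lam) : lam = mu := by
  have hsum : ∀ k, ∑ i ∈ Finset.range k, lam.part i = ∑ i ∈ Finset.range k, mu.part i :=
    fun k => le_antisymm (h' k) (h k)
  have hpart : ∀ i, lam.part i = mu.part i := fun i => by
    have := hsum (i + 1)
    rw [Finset.sum_range_succ, Finset.sum_range_succ, hsum i] at this
    exact Nat.add_left_cancel this
  refine Subtype.ext (YoungDiagram.ext (Finset.ext fun c => ?_))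
  rw [YoungDiagram.mem_cells, YoungDiagram.mem_cells]
  obtain ⟨i, j⟩ := c
  rw [YoungDiagram.mem_iff_lt_rowLen, YoungDiagram.mem_iff_lt_rowLen]
  exact iff_of_eq (congrArg (j < ·) (hpart i))

/-! ### Homomorphisms from Specht modules to permutation modules -/

/-- The element of `M^μ` that is `a` times the tabloid `T`. -/
noncomputable def tabloidSingle (T : Tabloid mu) (a : F) : TabloidModule F mu :=
  (Finsupp.single T a : Tabloid mu →₀ F)

/-- The coefficient at the tabloid `T`. -/
noncomputable def coeffAt (F : Type*) [Field F] {n : ℕ} {mu : PartitionOf n} (T : Tabloid mu) :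
    TabloidModule F mu →ₗ[F] F :=
  (Finsupp.lapply T : (Tabloid mu →₀ F) →ₗ[F] F)

theorem tabloidModule_ext {v w : TabloidModule F mu} (h : ∀ T, coeffAt F T v = coeffAt F T w) :
    v = w :=
  Finsupp.ext h

theorem smul_tabloidSingle (c : F) (T : Tabloid mu) (a : F) :
    c • tabloidSingle T a = tabloidSingle T (c * a) :=
  Finsupp.smul_single c T a

theorem of_smul_eq (g : Perm (Fin n)) (v : TabloidModule F mu) :
    MonoidAlgebra.of F (Perm (Fin n)) g • v = tabloidRep F mu g v :=
  congrArg (fun f => f v) (Representation.asAlgebraHom_of (tabloidRep F mu) g)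

theorem coeffAt_of_smul (g : Perm (Fin n)) (v : TabloidModule F mu) (T : Tabloid mu) :
    coeffAt F T (MonoidAlgebra.of F (Perm (Fin n)) g • v) = coeffAt F (g⁻¹ • T) v := by
  obtain ⟨T, rfl⟩ := MulAction.surjective g T
  rw [of_smul_eq, inv_smul_smul]
  exact Finsupp.mapDomain_apply (MulAction.injective g) v T

theorem of_smul_tabloidSingle (g : Perm (Fin n)) (T : Tabloid mu) (a : F) :
    MonoidAlgebra.of F (Perm (Fin n)) g • tabloidSingle T a = tabloidSingle (g • T) a := by
  rw [of_smul_eq]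
  exact Finsupp.mapDomain_single

theorem polytabloid_eq (t : Tableau lam) :
    polytabloid F t = ∑ g ∈ colStabilizer t,
      tabloidSingle (g • t.tabloid) (((Perm.sign g : ℤˣ) : ℤ) : F) :=
  rfl

theorem of_smul_polytabloid (g : Perm (Fin n)) (t : Tableau lam) :
    MonoidAlgebra.of F (Perm (Fin n)) g • polytabloid F t = ∑ h ∈ colStabilizer t,
      tabloidSingle (g • h • t.tabloid) (((Perm.sign h : ℤˣ) : ℤ) : F) := by
  rw [polytabloid_eq, Finset.smul_sum]
  exact Finset.sum_congr rfl fun h _ => of_smul_tabloidSingle _ _ _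

theorem of_smul_polytabloid_of_mem {t : Tableau lam} {g : Perm (Fin n)}
    (hg : g ∈ colStabilizer t) :
    (MonoidAlgebra.of F (Perm (Fin n)) g • polytabloid F t : TabloidModule F lam) =
      (((Perm.sign g : ℤˣ) : ℤ) : F) • polytabloid F t := by
  rw [of_smul_polytabloid, polytabloid_eq, Finset.smul_sum]
  have hg' : ∀ x, t.col (g x) = t.col x := by simpa [colStabilizer] using hg
  refine Finset.sum_bij (fun h _ => g * h) (fun h hh => ?_) (fun _ _ _ _ => mul_left_cancel)
    (fun h hh => ⟨g⁻¹ * h, ?_, by simp⟩) (fun h _ => ?_)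
  · have hh' : ∀ x, t.col (h x) = t.col x := by simpa [colStabilizer] using hh
    simp [colStabilizer, hg', hh']
  · have hh' : ∀ x, t.col (h x) = t.col x := by simpa [colStabilizer] using hh
    simp only [colStabilizer, Finset.mem_filter, Finset.mem_univ, true_and, Perm.mul_apply]
    intro x
    rw [← hg' (g⁻¹ (h x)), ← Perm.mul_apply, mul_inv_cancel, Perm.one_apply, hh']
  · rw [smul_tabloidSingle, smul_smul]
    congr 1
    rw [Perm.sign_mul, Units.val_mul, Int.cast_mul, ← mul_assoc]
    have : (((Perm.sign g : ℤˣ) : ℤ) : F) * (((Perm.sign g : ℤˣ) : ℤ) : F) = 1 := by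
      rcases Int.units_eq_one_or (Perm.sign g) with h | h <;> simp [h]
    rw [this, one_mul]

theorem polytabloid_trans (t : Tableau lam) (g : Perm (Fin n)) :
    polytabloid F (t.trans g : Tableau lam) =
      MonoidAlgebra.of F (Perm (Fin n)) g • polytabloid F t := by
  rw [of_smul_polytabloid, polytabloid_eq]
  have hcol : ∀ x, Tableau.col (t.trans g : Tableau lam) x = t.col (g⁻¹ x) := fun _ => rfl
  have htab : Tableau.tabloid (t.trans g : Tableau lam) = g • t.tabloid := Subtype.ext rfl
  refine (Finset.sum_bij (fun h _ => g * h * g⁻¹) (fun h hh => ?_) (fun _ _ _ _ e => ?_)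
    (fun h hh => ⟨g⁻¹ * h * g, ?_, ?_⟩) (fun h _ => ?_)).symm
  · have hh' : ∀ x, t.col (h x) = t.col x := by simpa [colStabilizer] using hh
    simp [colStabilizer, hcol, hh']
  · simpa using e
  · have hh' : ∀ x, t.col (g⁻¹ (h x)) = t.col (g⁻¹ x) := by
      simpa [colStabilizer, hcol] using hh
    simp only [colStabilizer, Finset.mem_filter, Finset.mem_univ, true_and, Perm.mul_apply]
    intro x
    rw [hh']
    simp
  · group
  · rw [htab, smul_smul, smul_smul, inv_mul_cancel_right,
      Perm.sign_mul, Perm.sign_mul, Perm.sign_inv, mul_right_comm, Int.units_mul_self, one_mul]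

/-- A column permutation that also preserves the rows of `t` is the identity, so `{t}` occurs in
`e_t` only once. -/
theorem polytabloid_apply_tabloid (t : Tableau lam) :
    coeffAt F t.tabloid (polytabloid F t) = 1 := by
  rw [polytabloid_eq, map_sum, Finset.sum_eq_single 1]
  · rw [one_smul, Perm.sign_one]
    exact (Finsupp.single_eq_same).trans Int.cast_one
  · intro g hg hne
    have hg' : ∀ x, t.col (g x) = t.col x := by simpa [colStabilizer] using hg
    refine Finsupp.single_eq_of_ne fun h => hne ?_
    ext x : 1
    refine t.ext_row_col ?_ (hg' x)
    have := congrFun (congrArg Subtype.val h) (g x)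
    rw [smul_tabloid_apply, ← Perm.mul_apply, inv_mul_cancel, Perm.one_apply] at this
    exact this
  · intro h
    simp [colStabilizer] at h

/-- The polytabloid `e_t` as an element of the Specht module. -/
noncomputable def spechtGenerator (F : Type*) [Field F] {n : ℕ} {lam : PartitionOf n} (t : Tableau lam) :
    spechtModule F lam :=
  ⟨polytabloid F t, Submodule.subset_span ⟨t, rfl⟩⟩

theorem specht_hom_eq_zero {V : Type*} [AddCommGroup V]
    [Module (MonoidAlgebra F (Perm (Fin n))) V]
    (θ : spechtModule F lam →ₗ[MonoidAlgebra F (Perm (Fin n))] V)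
    (h : ∀ t, θ (spechtGenerator F t) = 0) : θ = 0 := by
  ext ⟨v, hv⟩
  rw [LinearMap.zero_apply]
  induction hv using Submodule.span_induction with
  | mem x hx =>
    obtain ⟨t, rfl⟩ := hx
    exact h t
  | zero => exact map_zero θ
  | add x y hx hy h1 h2 =>
    have := map_add θ ⟨x, hx⟩ ⟨y, hy⟩
    rw [h1, h2, add_zero] at this
    exact this
  | smul a x hx h1 =>
    have := map_smul θ a ⟨x, hx⟩
    rw [h1, smul_zero] at this
    exact this

section Hom

variable (θ : spechtModule F lam →ₗ[MonoidAlgebra F (Perm (Fin n))] TabloidModule F mu)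

theorem hom_generator_apply_inv_smul {t : Tableau lam} {g : Perm (Fin n)}
    (hg : g ∈ colStabilizer t) (T : Tabloid mu) :
    coeffAt F (g⁻¹ • T) (θ (spechtGenerator F t)) =
      (((Perm.sign g : ℤˣ) : ℤ) : F) * coeffAt F T (θ (spechtGenerator F t)) := by
  rw [← coeffAt_of_smul, ← map_smul]
  have h : MonoidAlgebra.of F (Perm (Fin n)) g • spechtGenerator F t =
      (algebraMap F (MonoidAlgebra F (Perm (Fin n))) (((Perm.sign g : ℤˣ) : ℤ) : F)) •
        spechtGenerator F t :=
    Subtype.ext ((of_smul_polytabloid_of_mem hg).trans (algebraMap_smul _ _ _).symm)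
  rw [h, map_smul, algebraMap_smul, map_smul, smul_eq_mul]

/-- A transposition of two letters sharing a column of `t` and a row of `T` fixes `T` but negates
`e_t`. The coefficient at `T` then equals its own negative. -/
theorem hom_generator_colInjective (hF : ringChar F ≠ 2) {t : Tableau lam} {T : Tabloid mu}
    (hT : coeffAt F T (θ (spechtGenerator F t)) ≠ 0) : ColInjective t T := by
  intro x y hcol hrow
  by_contra hne
  have hmem : swap x y ∈ colStabilizer t := by
    simp only [colStabilizer, Finset.mem_filter, Finset.mem_univ, true_and]
    intro w
    rw [swap_apply_def]
    split_ifs with h1 h2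
    · rw [h1, hcol]
    · rw [h2, hcol]
    · rfl
  have hfix : (swap x y)⁻¹ • T = T := by
    refine Subtype.ext (funext fun w => ?_)
    rw [smul_tabloid_apply, inv_inv, swap_apply_def]
    split_ifs with h1 h2
    · rw [h1, hrow]
    · rw [h2, hrow]
    · rfl
  have h := hom_generator_apply_inv_smul θ hmem T
  rw [hfix, Perm.sign_swap hne] at h
  refine hT ?_
  set a := coeffAt F T (θ (spechtGenerator F t))
  have h' : a = -a := by simpa using h
  exact (Ring.eq_self_iff_eq_zero_of_char_ne_two hF).1 h'.symm

theorem specht_hom_tabloidModule_eq_zero (hF : ringChar F ≠ 2) (h : ¬ Dominates lam mu) :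
    θ = 0 := by
  refine specht_hom_eq_zero θ fun t => tabloidModule_ext fun T => ?_
  by_contra hT
  exact h (hom_generator_colInjective θ hF hT).dominates

end Hom

theorem specht_hom_specht_eq_zero (hF : ringChar F ≠ 2) (h : ¬ Dominates lam mu)
    (θ : spechtModule F lam →ₗ[MonoidAlgebra F (Perm (Fin n))] spechtModule F mu) : θ = 0 := by
  have := specht_hom_tabloidModule_eq_zero ((spechtModule F mu).subtype ∘ₗ θ) hF h
  ext x
  exact congrArg (fun f => f x) this

/-- Every tabloid occurring in `θ(e_t)` is a column permutation of `{t}`, so its coefficient is that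
at `{t}` up to sign. All other polytabloids are translates of `e_t`. -/
theorem specht_hom_eq_zero_of_apply (hF : ringChar F ≠ 2)
    (θ : spechtModule F lam →ₗ[MonoidAlgebra F (Perm (Fin n))] TabloidModule F lam)
    (t : Tableau lam)
    (h : coeffAt F t.tabloid (θ (spechtGenerator F t)) = 0) : θ = 0 := by
  have ht : θ (spechtGenerator F t) = 0 := by
    refine tabloidModule_ext fun T => ?_
    by_contra hT
    obtain ⟨g, hg, rfl⟩ := (hom_generator_colInjective θ hF hT).exists_smul_eq
    refine hT ?_
    rw [hom_generator_apply_inv_smul θ hg, h, mul_zero, map_zero]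
  refine specht_hom_eq_zero θ fun s => ?_
  have hs : spechtGenerator F s =
      MonoidAlgebra.of F (Perm (Fin n)) (t.symm.trans s) • spechtGenerator F t := by
    refine Subtype.ext (Eq.trans ?_ (polytabloid_trans t (t.symm.trans s)))
    change polytabloid F s = polytabloid F _
    congr 1
    ext; simp
  rw [hs, map_smul, ht, smul_zero]

theorem exists_tableau (lam : PartitionOf n) : Nonempty (Tableau lam) :=
  ⟨Fintype.equivFinOfCardEq (by rw [Fintype.card_coe]; exact lam.2)⟩

theorem specht_end_scalar (hF : ringChar F ≠ 2)
    (θ : spechtModule F lam →ₗ[MonoidAlgebra F (Perm (Fin n))] spechtModule F lam) :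
    ∃ c : F, ∀ x, θ x = algebraMap F (MonoidAlgebra F (Perm (Fin n))) c • x := by
  obtain ⟨t⟩ := exists_tableau lam
  set c : F := coeffAt F t.tabloid (θ (spechtGenerator F t)).1 with hc
  let σ : spechtModule F lam →ₗ[MonoidAlgebra F (Perm (Fin n))] TabloidModule F lam :=
    { toFun := fun x => c • x.1
      map_add' := fun x y => smul_add c x.1 y.1
      map_smul' := fun a x => (smul_algebra_smul_comm c a x.1).symm }
  -- Since `{t}` has coefficient 1 in `e_t`, the map `θ - c` has coefficient 0 there.
  have h := specht_hom_eq_zero_of_apply hF ((spechtModule F lam).subtype ∘ₗ θ - σ) t (by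
    rw [LinearMap.sub_apply, map_sub]
    change c - coeffAt F t.tabloid (c • polytabloid F t) = 0
    rw [map_smul, smul_eq_mul]
    rw [polytabloid_apply_tabloid, mul_one, sub_self])
  refine ⟨c, fun x => Subtype.ext ?_⟩
  refine (sub_eq_zero.1 (congrArg (fun f => f x) h)).trans (algebraMap_smul _ _ _).symm

theorem spechtGenerator_ne_zero (t : Tableau lam) : spechtGenerator F t ≠ 0 := by
  intro h
  have h' : coeffAt F t.tabloid (polytabloid F t) = 0 := by
    have : polytabloid F t = 0 := congrArg Subtype.val h
    rw [this, map_zero]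
  rw [polytabloid_apply_tabloid] at h'
  exact one_ne_zero h'

theorem specht_nontrivial (F : Type*) [Field F] (lam : PartitionOf n) :
    Nontrivial (spechtModule F lam) :=
  let ⟨t⟩ := exists_tableau lam
  ⟨⟨spechtGenerator F t, 0, spechtGenerator_ne_zero t⟩⟩

/-! ### Filtrations with rigid factors -/

/-- The action of the center on a module by module endomorphisms. -/
def centerEnd (F : Type*) [Field F] {A : Type*} [Ring A] [Algebra F A] (M : Type*)
    [AddCommGroup M] [Module A M] : Subalgebra.center F A →+* Module.End A M where
  toFun z :=
    { toFun := fun x => z.1 • x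
      map_add' := smul_add z.1
      map_smul' := fun a x => by
        rw [RingHom.id_apply, smul_smul, smul_smul, Subalgebra.mem_center_iff.1 z.2 a] }
  map_one' := by ext; simp
  map_zero' := by ext; simp
  map_add' a b := by ext; simp [add_smul]
  map_mul' a b := by
    ext x
    exact mul_smul a.1 b.1 x

@[simp]
theorem centerEnd_apply {F : Type*} [Field F] {A : Type*} [Ring A] [Algebra F A] {M : Type*}
    [AddCommGroup M] [Module A M] (z : Subalgebra.center F A) (x : M) : centerEnd F M z x = z.1 • x := rfl

section Rigid

variable {F : Type*} [Field F] {A : Type*} [Ring A] [Algebra F A]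
  {M : Type*} [AddCommGroup M] [Module F M] [Module A M] [IsScalarTower F A M] {m : ℕ}

/-- A finite filtration whose factors are nonzero, have only scalar endomorphisms, and admit no
nonzero homomorphisms from lower to higher ones. The last two conditions are stated for the maps
induced by endomorphisms of the whole module. -/
structure IsRigidFiltration (F : Type*) [Field F] {A : Type*} [Ring A] [Algebra F A]
    {M : Type*} [AddCommGroup M] [Module F M] [Module A M] {m : ℕ}
    (N : Fin (m + 1) → Submodule A M) : Prop where
  bot : N 0 = ⊥
  top : N (Fin.last m) = ⊤
  le : ∀ u : Fin m, N u.castSucc ≤ N u.succ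
  exists_notMem : ∀ u : Fin m, ∃ x ∈ N u.succ, x ∉ N u.castSucc
  hom : ∀ u v : Fin m, u < v → ∀ f : Module.End A M, (∀ x ∈ N u.succ, f x ∈ N v.succ) →
    (∀ x ∈ N u.castSucc, f x ∈ N v.castSucc) → ∀ x ∈ N u.succ, f x ∈ N v.castSucc
  scalar : ∀ (u : Fin m) (f : Module.End A M), (∀ x ∈ N u.succ, f x ∈ N u.succ) →
    (∀ x ∈ N u.castSucc, f x ∈ N u.castSucc) →
      ∃ c : F, ∀ x ∈ N u.succ, f x - c • x ∈ N u.castSucc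

/-! ### Endomorphisms of a module with a rigid filtration -/

namespace IsRigidFiltration

variable {N : Fin (m + 1) → Submodule A M}

omit [IsScalarTower F A M] in
theorem map_mem (h : IsRigidFiltration F N) (f : Module.End A M) (i : Fin (m + 1)) :
    ∀ x ∈ N i, f x ∈ N i := by
  have hmono : Monotone N := Fin.monotone_iff_le_succ.2 h.le
  induction i using Fin.induction with
  | zero =>
    intro x hx
    rw [h.bot, Submodule.mem_bot] at hx ⊢
    rw [hx, map_zero]
  | succ i ih =>
    -- Push the image of `N i.succ` down from `N (Fin.last m) = ⊤`: above level `i`, each induced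
    -- map from the factor at `i` to the factor at `j` vanishes.
    suffices H : ∀ j : Fin (m + 1), i.succ ≤ j → ∀ x ∈ N i.succ, f x ∈ N j from H _ le_rfl
    intro j
    induction j using Fin.reverseInduction with
    | last =>
      intro _ x _
      rw [h.top]
      trivial
    | cast j ih' =>
      intro hij
      have hij' : i < j := by
        rw [Fin.lt_def]
        have := Fin.le_def.1 hij
        simp only [Fin.val_succ, Fin.val_castSucc] at this
        omega
      exact h.hom i j hij' f
        (ih' (hij.trans (Fin.castSucc_lt_succ).le))
        fun x hx => hmono (Fin.castSucc_le_castSucc_iff.2 hij'.le) (ih x hx)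

omit [IsScalarTower F A M] in
theorem exists_scalar (h : IsRigidFiltration F N) (u : Fin m) (f : Module.End A M) :
    ∃ c : F, ∀ x ∈ N u.succ, f x - c • x ∈ N u.castSucc :=
  h.scalar u f (h.map_mem f _) (h.map_mem f _)

/-- The scalar by which an endomorphism acts on a factor of a rigid filtration. -/
noncomputable def factorScalar (h : IsRigidFiltration F N) (u : Fin m) (f : Module.End A M) : F :=
  (h.exists_scalar u f).choose

omit [IsScalarTower F A M] in
theorem sub_factorScalar_mem (h : IsRigidFiltration F N) (u : Fin m) (f : Module.End A M)
    {x : M} (hx : x ∈ N u.succ) : f x - h.factorScalar u f • x ∈ N u.castSucc :=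
  (h.exists_scalar u f).choose_spec x hx

/-- Uniqueness of the scalar, since the factor is nonzero; it yields every ring homomorphism law of
`factorHom`. -/
theorem factorScalar_eq (h : IsRigidFiltration F N) {u : Fin m} {f : Module.End A M} {c : F}
    (hc : ∀ x ∈ N u.succ, f x - c • x ∈ N u.castSucc) : h.factorScalar u f = c := by
  obtain ⟨x, hx, hx'⟩ := h.exists_notMem u
  by_contra hne
  have h1 := sub_mem (hc x hx) (h.sub_factorScalar_mem u f hx)
  rw [sub_sub_sub_cancel_left, ← sub_smul] at h1
  exact hx' ((Submodule.smul_mem_iff _ (sub_ne_zero.2 hne)).1 h1)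

/-- The action of endomorphisms on a factor of a rigid filtration, as a ring homomorphism. -/
noncomputable def factorHom (h : IsRigidFiltration F N) (u : Fin m) : Module.End A M →+* F where
  toFun := h.factorScalar u
  map_one' := h.factorScalar_eq fun x _ => by simp
  map_zero' := h.factorScalar_eq fun x _ => by simp
  map_add' f g := h.factorScalar_eq fun x hx => by
    have := add_mem (h.sub_factorScalar_mem u f hx) (h.sub_factorScalar_mem u g hx)
    rw [LinearMap.add_apply, add_smul]
    convert this using 1
    abel
  map_mul' f g := h.factorScalar_eq fun x hx => by
    have h1 := h.map_mem f _ _ (h.sub_factorScalar_mem u g hx)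
    have h2 := (N u.castSucc).smul_of_tower_mem (h.factorScalar u g)
      (h.sub_factorScalar_mem u f hx)
    rw [map_sub, LinearMap.map_smul_of_tower] at h1
    have := add_mem h1 h2
    rw [smul_sub, smul_smul, sub_add_sub_cancel] at this
    rwa [Module.End.mul_apply, mul_comm]

theorem sub_factorHom_mem (h : IsRigidFiltration F N) (u : Fin m) (f : Module.End A M)
    {x : M} (hx : x ∈ N u.succ) : f x - h.factorHom u f • x ∈ N u.castSucc :=
  h.sub_factorScalar_mem u f hx

theorem factorHom_algebraMap (h : IsRigidFiltration F N) (u : Fin m) (c : F) :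
    h.factorHom u (centerEnd F M (algebraMap F _ c)) = c :=
  h.factorScalar_eq fun x _ => by
    rw [centerEnd_apply, Subalgebra.coe_algebraMap, algebraMap_smul, sub_self]
    exact zero_mem _

open scoped Classical in
theorem aeval_smul_idempotent (h : IsRigidFiltration F N) (z : Subalgebra.center F A)
    {e : Module.End A M} (he : e * e = e) (x : M) :
    Polynomial.aeval z.1 (∏ u with h.factorHom u e ≠ 0,
      (Polynomial.X - Polynomial.C (h.factorHom u (centerEnd F M z)))) • e x = 0 := by
  suffices H : ∀ i : Fin (m + 1), ∀ x ∈ N i, Polynomial.aeval z.1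
      (∏ u with h.factorHom u e ≠ 0 ∧ u.castSucc < i,
        (Polynomial.X - Polynomial.C (h.factorHom u (centerEnd F M z)))) • e x = 0 by
    have := H (Fin.last m) x (h.top ▸ trivial)
    simpa [Fin.castSucc_lt_last] using this
  intro i
  induction i using Fin.induction with
  | zero =>
    intro x hx
    rw [h.bot, Submodule.mem_bot] at hx
    rw [hx, map_zero, smul_zero]
  | succ i ih =>
    intro x hx
    -- If the scalar is 0, then `e` sends `x` one level down and `e x = e (e x)`, so no new linear
    -- factor is needed. Otherwise the factor for `i` sends `x` one level down and commutes with
    -- `e`.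
    by_cases hi : h.factorHom i e = 0
    · have hset : (Finset.univ.filter fun u => h.factorHom u e ≠ 0 ∧ u.castSucc < i.succ) =
          Finset.univ.filter fun u => h.factorHom u e ≠ 0 ∧ u.castSucc < i.castSucc := by
        ext u
        simp only [Finset.mem_filter, Finset.mem_univ, true_and, Fin.castSucc_lt_castSucc_iff,
          Fin.castSucc_lt_succ_iff]
        refine and_congr_right fun hu => ⟨fun hle => lt_of_le_of_ne hle ?_, le_of_lt⟩
        rintro rfl
        exact hu hi
      have hx' := h.sub_factorHom_mem i e hx
      rw [hi, zero_smul, sub_zero] at hx'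
      have := ih _ hx'
      rwa [← Module.End.mul_apply, he, ← hset] at this
    · have hset : (Finset.univ.filter fun u => h.factorHom u e ≠ 0 ∧ u.castSucc < i.succ) =
          insert i
            (Finset.univ.filter fun u => h.factorHom u e ≠ 0 ∧ u.castSucc < i.castSucc) := by
        ext u
        simp only [Finset.mem_filter, Finset.mem_univ, true_and, Fin.castSucc_lt_castSucc_iff,
          Fin.castSucc_lt_succ_iff, Finset.mem_insert, le_iff_eq_or_lt]
        constructor
        · tauto
        · rintro (rfl | hu)
          · exact ⟨hi, Or.inl rfl⟩
          · exact ⟨hu.1, Or.inr hu.2⟩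
      have hx' := h.sub_factorHom_mem i (centerEnd F M z) hx
      have := ih _ hx'
      rw [hset, Finset.prod_insert (by simp), mul_comm, map_mul, mul_smul]
      rw [map_sub, LinearMap.map_smul_of_tower, centerEnd_apply, map_smul] at this
      rw [map_sub, Polynomial.aeval_X, Polynomial.aeval_C, sub_smul, algebraMap_smul]
      exact this

theorem eq_zero_of_factorHom_eq_zero (h : IsRigidFiltration F N) {e : Module.End A M}
    (he : e * e = e) (h0 : ∀ u, h.factorHom u e = 0) : e = 0 := by
  ext x
  simpa [h0] using h.aeval_smul_idempotent 0 he x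

/-- If two characters of the center that are nonzero on `B` differed at `z`, some `w` in the ideal
generated by `B` would vanish under one and not the other. Stabilization of the powers of `w` in the
Artinian center turns `w` into an idempotent below `B` with values 0 and 1, contradicting
primitivity. -/
theorem factorHom_eq_of_block (h : IsRigidFiltration F N) [FiniteDimensional F A] {B : A}
    (hB : IsBlockIdempotent B) (hBc : B ∈ Subalgebra.center F A) (z : Subalgebra.center F A)
    {u v : Fin m} (hu : h.factorHom u (centerEnd F M ⟨B, hBc⟩) ≠ 0)
    (hv : h.factorHom v (centerEnd F M ⟨B, hBc⟩) ≠ 0) :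
    h.factorHom u (centerEnd F M z) = h.factorHom v (centerEnd F M z) := by
  by_contra hne
  let Z := Subalgebra.center F A
  set b : Z := ⟨B, hBc⟩ with hb
  have hbb : b * b = b := Subtype.ext hB.idem
  set χ : Fin m → Z →+* F := fun w => (h.factorHom w).comp (centerEnd F M)
  change ¬ χ u z = χ v z at hne
  change χ u b ≠ 0 at hu
  change χ v b ≠ 0 at hv
  have hχ : ∀ (w : Fin m) (c : F), χ w (algebraMap F Z c) = c := h.factorHom_algebraMap
  set w : Z := (z - algebraMap F Z (χ u z)) * b with hw
  have hwu : χ u w = 0 := by rw [hw, map_mul, map_sub, hχ, sub_self, zero_mul]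
  have hwv : χ v w ≠ 0 := by
    rw [hw, map_mul, map_sub, hχ]
    exact mul_ne_zero (sub_ne_zero.2 (Ne.symm hne)) hv
  have hwb : w * b = w := by rw [hw, mul_assoc, hbb]
  have : FiniteDimensional F Z := inferInstanceAs (FiniteDimensional F Z.toSubmodule)
  have : IsArtinianRing Z := IsArtinianRing.of_finite F Z
  obtain ⟨k, y, hy⟩ := IsArtinian.exists_pow_succ_smul_dvd w (1 : Z)
  have hy' : w ^ k * (w * y) = w ^ k := by
    simp only [smul_eq_mul, mul_one] at hy
    rw [← mul_assoc, ← pow_succ, hy]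
  have hpow : ∀ j, w ^ k * (w * y) ^ j = w ^ k := fun j => by
    induction j with
    | zero => simp
    | succ j ih => rw [pow_succ, ← mul_assoc, ih, hy']
  -- The exponent makes `f` a multiple of `w ^ k`, which absorbs powers of `w * y`; being positive
  -- even for `k = 0`, it also makes `f` a multiple of `w`.
  set f : Z := (w * y) ^ (k + 1) with hf
  have hff : f * f = f := by
    calc f * f = (w ^ k * (w * y) ^ (k + 1)) * (w * y ^ (k + 1)) := by rw [hf]; ring
      _ = f := by rw [hpow, hf]; ring
  have hfb : f * b = f := by
    rw [hf, pow_succ, mul_assoc, mul_right_comm w y b, hwb]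
  have hfu : χ u f = 0 := by rw [hf, map_pow, map_mul, hwu]; simp
  have hfv : χ v f = 1 := by
    have := congrArg (χ v) hy'
    rw [map_mul, map_pow] at this
    rw [hf, map_pow, mul_left_cancel₀ (pow_ne_zero k hwv) (this.trans (mul_one _).symm), one_pow]
  rcases hB.primitive f.1 f.2 (congrArg Subtype.val hff) (congrArg Subtype.val hfb) with h0 | h1
  · rw [show f = 0 from Subtype.ext h0, map_zero] at hfv
    exact zero_ne_one hfv
  · rw [show f = b from Subtype.ext h1] at hfu
    exact hu hfu

theorem natDegree_minpoly_lt (h : IsRigidFiltration F N) (z : Subalgebra.center F A)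
    {e₁ e₂ e₃ : Module.End A M} (he₁ : e₁ * e₁ = e₁) (he₂ : e₂ * e₂ = e₂) (he₃ : e₃ * e₃ = e₃)
    (h₁₂ : e₁ * e₂ = 0) (h₁₃ : e₁ * e₃ = 0) (h₂₃ : e₂ * e₃ = 0) (hsum : e₁ + e₂ + e₃ = 1)
    (hne₁ : e₁ ≠ 0) (hne₂ : e₂ ≠ 0) (c : F)
    (hc₁ : ∀ u, h.factorHom u e₁ ≠ 0 → h.factorHom u (centerEnd F M z) = c)
    (hc₂ : ∀ u, h.factorHom u e₂ ≠ 0 → h.factorHom u (centerEnd F M z) = c) :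
    (minpoly F (Algebra.lsmul F F M z.1)).natDegree < m := by
  classical
  open Polynomial in
  let J : Module.End A M → Finset (Fin m) := fun e => {u | h.factorHom u e ≠ 0}
  have hJ : ∀ e u, u ∈ J e ↔ h.factorHom u e ≠ 0 := fun e u => by simp [J]
  have hdisj : ∀ e e', e * e' = 0 → Disjoint (J e) (J e') := fun e e' hee =>
    Finset.disjoint_left.2 fun u hu hu' => by
      have := congrArg (h.factorHom u) hee
      rw [map_mul, map_zero] at this
      exact (mul_ne_zero ((hJ e u).1 hu) ((hJ e' u).1 hu')) this
  have hpos : ∀ e, e * e = e → e ≠ 0 → 0 < (J e).card := fun e he hne => by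
    rw [Finset.card_pos, Finset.nonempty_iff_ne_empty]
    refine fun hemp => hne (h.eq_zero_of_factorHom_eq_zero he fun u => ?_)
    by_contra hu
    have := (hJ e u).2 hu
    simp [hemp] at this
  have hcard : (J e₁).card + (J e₂).card + (J e₃).card ≤ m := by
    rw [← Finset.card_union_of_disjoint (hdisj _ _ h₁₂), ← Finset.card_union_of_disjoint
      (Finset.disjoint_union_left.2 ⟨hdisj _ _ h₁₃, hdisj _ _ h₂₃⟩)]
    exact (Finset.card_le_univ _).trans_eq (Fintype.card_fin m)
  have hp₁ := hpos _ he₁ hne₁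
  have hp₂ := hpos _ he₂ hne₂
  set q : F[X] := ∏ u ∈ J e₃, (X - C (h.factorHom u (centerEnd F M z)))
  -- One power of `X - c` serves both pieces. As both cardinalities are positive, their maximum is
  -- smaller than their sum.
  set k := max (J e₁).card (J e₂).card with hk
  have hqm : q.Monic := monic_prod_of_monic _ _ fun u _ => monic_X_sub_C _
  have hqd : q.natDegree = (J e₃).card := natDegree_finsetProd_X_sub_C_eq_card _ _
  have hpm : ((X - C c) ^ k * q).Monic := ((monic_X_sub_C c).pow k).mul hqm
  have hpd : ((X - C c) ^ k * q).natDegree = k + (J e₃).card := by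
    rw [((monic_X_sub_C c).pow k).natDegree_mul hqm, hqd, natDegree_pow, natDegree_X_sub_C, mul_one]
  have hkill : ∀ e, e * e = e → (∀ u, h.factorHom u e ≠ 0 →
      h.factorHom u (centerEnd F M z) = c) → (J e).card ≤ k → ∀ x,
      aeval z.1 ((X - C c) ^ k * q) • e x = 0 := fun e he hc hle x => by
    have h0 := h.aeval_smul_idempotent z he x
    rw [Finset.prod_congr rfl (g := fun _ => X - C c) fun u hu => by
      rw [hc u (by simpa using hu)], Finset.prod_const] at h0
    change aeval z.1 ((X - C c) ^ (J e).card) • e x = 0 at h0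
    obtain ⟨r, hr⟩ := Nat.exists_eq_add_of_le hle
    rw [hr, pow_add, mul_right_comm, mul_assoc, mul_comm, map_mul, mul_smul, h0, smul_zero]
  have haeval : aeval (Algebra.lsmul F F M z.1) ((X - C c) ^ k * q) = 0 := by
    rw [aeval_algHom_apply]
    ext x
    have h₃ : aeval z.1 ((X - C c) ^ k * q) • e₃ x = 0 := by
      rw [map_mul, mul_smul, h.aeval_smul_idempotent z he₃ x, smul_zero]
    have hx : x = e₁ x + e₂ x + e₃ x := by
      rw [← LinearMap.add_apply, ← LinearMap.add_apply, hsum, Module.End.one_apply]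
    change aeval z.1 ((X - C c) ^ k * q) • x = 0
    rw [hx, smul_add, smul_add, hkill e₁ he₁ hc₁ (le_max_left _ _),
      hkill e₂ he₂ hc₂ (le_max_right _ _), h₃, add_zero, add_zero]
  have := natDegree_le_natDegree (minpoly.min F _ hpm haeval)
  rw [hpd] at this
  omega

theorem centralImage_eq_bot_or_isIndecomposable (h : IsRigidFiltration F N)
    [FiniteDimensional F A] {z : A} (hz : z ∈ Set.center A)
    (hdeg : (minpoly F (Algebra.lsmul F F M z)).natDegree = m) {B : A}
    (hB : IsBlockIdempotent B) :
    centralImage M B hB.central = ⊥ ∨ IsIndecomposable A (centralImage M B hB.central) := by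
  refine or_iff_not_imp_left.2 fun hne =>
    ⟨Submodule.nontrivial_iff_ne_bot.2 hne, fun P Q hPQ => ?_⟩
  by_contra! hcon
  have hBc : B ∈ Subalgebra.center F A := hB.central
  set b : Module.End A M := centerEnd F M ⟨B, hBc⟩ with hb
  have hbb : b * b = b := by
    rw [hb, ← map_mul]
    exact congrArg _ (Subtype.ext hB.idem)
  let β : M →ₗ[A] centralImage M B hB.central := b.codRestrict _ fun x => ⟨x, rfl⟩
  let ι := (centralImage M B hB.central).subtype
  have hβ : ∀ x, β (ι x) = x := by
    rintro ⟨_, x, rfl⟩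
    exact Subtype.ext (congrArg (fun f => f x) hbb)
  have hιβ : ∀ x, ι (β x) = b x := fun _ => rfl
  -- Extension by zero on the complement `(1 - B)M`; it is multiplicative and carries the
  -- projections of the summands to orthogonal idempotents of `End(M)`.
  let E : Module.End A (centralImage M B hB.central) → Module.End A M := fun p => ι ∘ₗ p ∘ₗ β
  have hEmul : ∀ p p', E p * E p' = E (p * p') := fun p p' => by
    ext x
    exact congrArg (fun y => ι (p y)) (hβ _)
  have hbE : ∀ p, b * E p = E p := fun p => by
    ext x
    exact congrArg ι (hβ _)
  have hEb : ∀ p, E p * b = E p := fun p => by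
    ext x
    exact congrArg (fun y => ι (p y)) (hβ (β x))
  have hEne : ∀ p, p ≠ 0 → E p ≠ 0 := fun p hp h0 => hp (by
    refine LinearMap.ext fun x => Subtype.ext ?_
    refine Eq.trans ?_ (congrArg (fun f => f (ι x)) h0)
    exact congrArg (fun y => ι (p y)) (hβ x).symm)
  set p := P.projection Q hPQ with hp
  have hpp : p * p = p := Submodule.isIdempotentElem_projection hPQ
  have hp0 : p ≠ 0 := fun h0 => hcon.1 (by
    rw [← Submodule.range_projection hPQ, ← hp, h0, LinearMap.range_zero])
  have hp1 : 1 - p ≠ 0 := fun h0 => hcon.2 (by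
    rw [← Submodule.ker_projection hPQ, ← hp, ← sub_eq_zero.1 h0]
    exact LinearMap.ker_id)
  have hE0 : E 0 = 0 := by
    ext x
    exact map_zero ι
  have hEsub : ∀ p, E p * (1 - b) = 0 := fun p => by rw [mul_sub, mul_one, hEb, sub_self]
  have hEsum : E p + E (1 - p) = b := by
    ext x
    change ι (p (β x)) + ι (β x - p (β x)) = b x
    rw [← map_add, add_sub_cancel, hιβ]
  have hχb : ∀ u p, h.factorHom u (E p) ≠ 0 → h.factorHom u b ≠ 0 := fun u p hu h0 => hu (by
    rw [← hbE, map_mul, h0, zero_mul])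
  -- The common scalar `c` is read off at any factor that the first summand meets.
  obtain ⟨u₀, hu₀⟩ : ∃ u, h.factorHom u (E p) ≠ 0 := by
    by_contra! h0
    exact hEne p hp0 (h.eq_zero_of_factorHom_eq_zero (by rw [hEmul, hpp]) h0)
  have hχ : ∀ u p, h.factorHom u (E p) ≠ 0 → h.factorHom u (centerEnd F M ⟨z, hz⟩) =
      h.factorHom u₀ (centerEnd F M ⟨z, hz⟩) := fun u p hu =>
    h.factorHom_eq_of_block hB hBc ⟨z, hz⟩ (hχb u p hu) (hχb u₀ _ hu₀)
  refine (h.natDegree_minpoly_lt ⟨z, hz⟩ (e₁ := E p) (e₂ := E (1 - p)) (e₃ := 1 - b)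
    ?_ ?_ ?_ ?_ (hEsub _) (hEsub _) ?_ (hEne _ hp0) (hEne _ hp1) _
    (fun u => hχ u p) (fun u => hχ u (1 - p))).ne hdeg
  · rw [hEmul, hpp]
  · rw [hEmul, (IsIdempotentElem.one_sub hpp).eq]
  · exact (IsIdempotentElem.one_sub hbb).eq
  · rw [hEmul, mul_sub, mul_one, hpp, sub_self, hE0]
  · rw [hEsum, add_sub_cancel]

end IsRigidFiltration

end Rigid

/-! ### Specht series as rigid filtrations -/

theorem exists_factor_map {A : Type*} [Ring A] {M : Type*} [AddCommGroup M] [Module A M]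
    {P Q P' Q' : Submodule A M} (f : Module.End A M) (hQ : ∀ x ∈ Q, f x ∈ Q')
    (hP : ∀ x ∈ P, f x ∈ P') :
    ∃ φ : (Q ⧸ P.submoduleOf Q) →ₗ[A] (Q' ⧸ P'.submoduleOf Q'), ∀ x (hx : x ∈ Q),
      φ (Submodule.Quotient.mk ⟨x, hx⟩) = Submodule.Quotient.mk ⟨f x, hQ x hx⟩ :=
  ⟨Submodule.mapQ _ _ (LinearMap.restrict f hQ) fun y hy => hP y.1 hy, fun _ _ => rfl⟩

theorem IsSpechtSeries.isRigidFiltration {F : Type*} [Field F] (hF : ringChar F ≠ 2) {n : ℕ}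
    {M : Type*} [AddCommGroup M] [Module F M] [Module (MonoidAlgebra F (Perm (Fin n))) M]
    [IsScalarTower F (MonoidAlgebra F (Perm (Fin n))) M] {m : ℕ}
    {N : Fin (m + 1) → Submodule (MonoidAlgebra F (Perm (Fin n))) M}
    {lam : Fin m → PartitionOf n} (hN : IsSpechtSeries N lam)
    (hlam : ∀ u v : Fin m, u < v → StrictlyDominates (lam v) (lam u)) :
    IsRigidFiltration F N where
  bot := hN.bot
  top := hN.top
  le := hN.le
  exists_notMem u := by
    obtain ⟨e⟩ := hN.factor u
    have := specht_nontrivial F (lam u)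
    have : Nontrivial (N u.succ ⧸ (N u.castSucc).submoduleOf (N u.succ)) := e.toEquiv.nontrivial
    have hne := Submodule.Quotient.nontrivial_iff.1 this
    by_contra! h
    exact hne (eq_top_iff.2 fun x _ => h x.1 x.2)
  hom u v huv f hf hf' x hx := by
    obtain ⟨e⟩ := hN.factor u
    obtain ⟨e'⟩ := hN.factor v
    obtain ⟨φ, hφ⟩ := exists_factor_map f hf hf'
    -- A nonzero map would make `lam u` dominate `lam v`; antisymmetry of dominance excludes this.
    have h0 := specht_hom_specht_eq_zero hF
      (fun hd => (hlam u v huv).2 (dominates_antisymm (hlam u v huv).1 hd))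
      (e'.toLinearMap ∘ₗ φ ∘ₗ e.symm.toLinearMap)
    have h1 : e' (φ (Submodule.Quotient.mk ⟨x, hx⟩)) = 0 := by
      have := congrArg (fun g => g (e (Submodule.Quotient.mk ⟨x, hx⟩))) h0
      simpa using this
    rw [LinearEquiv.map_eq_zero_iff, hφ, Submodule.Quotient.mk_eq_zero] at h1
    exact h1
  scalar u f hf hf' := by
    obtain ⟨e⟩ := hN.factor u
    obtain ⟨φ, hφ⟩ := exists_factor_map f hf hf'
    obtain ⟨c, hc⟩ := specht_end_scalar hF (e.toLinearMap ∘ₗ φ ∘ₗ e.symm.toLinearMap)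
    refine ⟨c, fun x hx => ?_⟩
    have h1 := hc (e (Submodule.Quotient.mk ⟨x, hx⟩))
    rw [← map_smul] at h1
    simp only [LinearMap.comp_apply, LinearEquiv.coe_coe, LinearEquiv.symm_apply_apply,
      EmbeddingLike.apply_eq_iff_eq] at h1
    rw [hφ, ← Submodule.Quotient.mk_smul, Submodule.Quotient.eq] at h1
    rw [← algebraMap_smul (MonoidAlgebra F (Perm (Fin n))) c x]
    exact h1

end SpechtBranching

theorem proposition3p3 {F : Type*} [Field F] (hF : ringChar F ≠ 2) (n : ℕ)
    {M : Type*} [AddCommGroup M] [Module F M] [Module (MonoidAlgebra F (Equiv.Perm (Fin n))) M]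
    [IsScalarTower F (MonoidAlgebra F (Equiv.Perm (Fin n))) M]
    (m : ℕ)
    (N : Fin (m + 1) → Submodule (MonoidAlgebra F (Equiv.Perm (Fin n))) M)
    (lam : Fin m → SpechtBranching.PartitionOf n)
    (hN : SpechtBranching.IsSpechtSeries N lam)
    (hlam : ∀ u v : Fin m, u < v → SpechtBranching.StrictlyDominates (lam v) (lam u))
    (z : MonoidAlgebra F (Equiv.Perm (Fin n)))
    (hz : z ∈ Set.center (MonoidAlgebra F (Equiv.Perm (Fin n))))
    (hdeg : (minpoly F (Algebra.lsmul F F M z)).natDegree = m)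
    (B : MonoidAlgebra F (Equiv.Perm (Fin n)))
    (hB : SpechtBranching.IsBlockIdempotent B) :
    SpechtBranching.centralImage M B hB.central = ⊥ ∨
      SpechtBranching.IsIndecomposable (MonoidAlgebra F (Equiv.Perm (Fin n)))
        (SpechtBranching.centralImage M B hB.central) := by
  exact (hN.isRigidFiltration hF hlam).centralImage_eq_bot_or_isIndecomposable hz hdeg hB
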